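/- Let $d\ge 3$, let $\mathbb B$ be the open unit ball and $\mathbb S$ the unit sphere of $\mathbb R^d$. Let $\phi$ (the radius function) and $\nu$ (the intensity) be Borel functions on $\mathbb B$ such that, for some constants $C>1$, $c<1$, $K$ and $r_0<1$, 1. $\frac1C\phi(x)\le\phi(y)\le C\phi(x)$ and $\frac1C\nu(x)\le\nu(y)\le C\nu(x)$ whenever $x\in\mathbb B$ and $|y-x|<\frac{1-|x|}{2}$ (in particular $\phi,\nu\ge 0$); 2. $\phi(x)/(1-|x|)\le c$ for all $x\in\mathbb B$; 3. $(1-|x|)\,\phi(x)^{d-2}\,\nu(x)\le K/(1-|x|)$ for all $x\in\mathbb B$ with $|x|\ge r_0$, that is, the left side is $O\big(1/(1-|x|)\big)$ as $|x|\to1^-$. Let $\mathcal P$ be a Poisson point process in $\mathbb B$ with mean measure $d\mu(x)=\nu(x)\,dx$, and let $A_{\mathcal P}=\bigcup_{p\in\mathcal P}\overline B(p,\phi(p))$. Let $\mathrm{cap}$ denote Newtonian capacity, normalised so that a ball of radius $r$ has capacity $r^{d-2}$. A Whitney cube is a closed cube $Q\subset\mathbb B$ of positive sidelength, with sides parallel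 to the axes, such that $\mathrm{diam}(Q)\le\mathrm{dist}(Q,\mathbb S)\le 4\,\mathrm{diam}(Q)$. Then there is a constant $M\ge1$, depending only on $d$, $C$, $c$, $K$ and $r_0$, such that for every Whitney cube $Q$ and every point $x\in Q$, $$\frac1M\,\phi(x)^{d-2}\,\mu(Q)\;\le\;\mathbb E\big[\mathrm{cap}(A_{\mathcal P}\cap Q)\big]\;\le\;M\,\phi(x)^{d-2}\,\mu(Q).$$ -/

import Mathlib

open MeasureTheory ProbabilityTheory
open scoped ENNReal NNReal

namespace PercolationDiffusion

/-- `d`-dimensional Euclidean space. -/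
abbrev Space (d : ℕ) : Type := EuclideanSpace ℝ (Fin d)

/-- The open unit ball. -/
def unitBall (d : ℕ) : Set (Space d) := Metric.ball 0 1

/-- The unit sphere. -/
def unitSphere (d : ℕ) : Set (Space d) := Metric.sphere 0 1

/-- The distance between two (non-empty) sets. -/
noncomputable def setDist {d : ℕ} (E F : Set (Space d)) : ℝ :=
  sInf {r : ℝ | ∃ x ∈ E, ∃ y ∈ F, r = dist x y}

/-- The closed cube with sides parallel to the axes, lower corner `a` and sidelength `l`. -/
def cube {d : ℕ} (a : Space d) (l : ℝ) : Set (Space d) :=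
  {x | ∀ i, a i ≤ x i ∧ x i ≤ a i + l}

/-- A Whitney cube of the unit ball: a non-degenerate cube contained in the ball whose distance to
the unit sphere is between one and four times its diameter. -/
def IsWhitneyCube {d : ℕ} (Q : Set (Space d)) : Prop :=
  (∃ (a : Space d) (l : ℝ), 0 < l ∧ Q = cube a l) ∧
    Q ⊆ unitBall d ∧
    Metric.diam Q ≤ setDist Q (unitSphere d) ∧
    setDist Q (unitSphere d) ≤ 4 * Metric.diam Q

/-- The Newtonian potential `∫ |x - y| ^ (2 - d) dm(y)` of the measure `m` at `x` (for `3 ≤ d`);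
the kernel is `∞` on the diagonal. -/
noncomputable def newtonPotential {d : ℕ} (m : Measure (Space d)) (x : Space d) : ℝ≥0∞ :=
  ∫⁻ y, (edist x y ^ (d - 2))⁻¹ ∂m

/-- The Newtonian capacity of a Borel set `E`: the supremum, over the compact subsets `K` of `E`,
of the total mass of a positive measure carried by `K` whose Newtonian potential is at most `1`
everywhere. With this normalisation a ball of radius `r` has capacity `r ^ (d - 2)`. -/
noncomputable def newtonCap {d : ℕ} (E : Set (Space d)) : ℝ≥0∞ :=
  ⨆ (K : Set (Space d)) (_ : K ⊆ E) (_ : IsCompact K)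
    (m : Measure (Space d)) (_ : m Kᶜ = 0) (_ : ∀ x, newtonPotential m x ≤ 1), m K

/-- The number of points of the configuration `S` in the set `A`. -/
noncomputable def pointCount {X : Type*} (S A : Set X) : ℕ∞ := (S ∩ A).encard

/-- The random set of points `P` is a Poisson point process with (atomless) mean measure `m`:
the number of points in a Borel set `A` is a Poisson variable with mean `m A` (almost surely
infinite if `m A = ∞`), and the numbers of points in disjoint Borel sets are independent. -/
structure IsPoissonProcess {Ω X : Type*} [MeasurableSpace Ω] [MeasurableSpace X]
    (Pr : Measure Ω) (m : Measure X) (P : Ω → Set X) : Prop where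
  measurable_count : ∀ A : Set X, MeasurableSet A → Measurable fun ω => pointCount (P ω) A
  law_count : ∀ A : Set X, MeasurableSet A → m A ≠ ∞ →
    Pr.map (fun ω => pointCount (P ω) A) =
      (poissonMeasure (m A).toNNReal).map (fun k : ℕ => (k : ℕ∞))
  count_eq_top : ∀ A : Set X, MeasurableSet A → m A = ∞ → ∀ᵐ ω ∂Pr, pointCount (P ω) A = ⊤
  indep_count : ∀ (n : ℕ) (A : Fin n → Set X), (∀ i, MeasurableSet (A i)) →
    Pairwise (fun i j => Disjoint (A i) (A j)) →
    iIndepFun (fun i ω => pointCount (P ω) (A i)) Pr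

/-- The measure `ν(x) dx` on the unit ball. -/
noncomputable def meanMeasure {d : ℕ} (ν : Space d → ℝ) : Measure (Space d) :=
  (volume.restrict (unitBall d)).withDensity fun x => ENNReal.ofReal (ν x)

/-- The archipelago: the union of the closed balls of radius `φ p` centred at the points `p` of the
configuration `S`. -/
def archipelago {d : ℕ} (φ : Space d → ℝ) (S : Set (Space d)) : Set (Space d) :=
  ⋃ p ∈ S, Metric.closedBall p (φ p)

end PercolationDiffusion

/-!
The upper bound is subadditivity. The potential at the centre of a ball of radius `r` bounds the
capacity of the ball by `r ^ (d - 2)`, so the capacity of `A_P ∩ Q` is at most the sum of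
`φ(p) ^ (d - 2)` over the points `p` of the process whose balls meet `Q`
(`newtonCap_le_of_subset_biUnion_closedBall`). Since `φ(p) ≤ c (1 - |p|)` with `c < 1`, these points
lie in a bounded hyperbolic neighbourhood of `Q` (`dist_le_reach_mul`). There `φ` and `ν` are
comparable to their values at `x`, by Harnack chains (`le_pow_mul_of_dist_lt`), and the mean number
of points is comparable to `μ(Q)`.

For the lower bound, `Q` is divided into `n ^ d` equal cells, with `n ^ d` of the order of
`max 1 μ(Q)`, and one point of the process is selected in the middle half of each cell where there
is one. The balls of radius `ρ`, a small multiple of `φ(x)`, about the selected points carry a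
multiple of Lebesgue measure with mass of the order of `φ(x) ^ (d - 2)` on each ball. Its potential
at a point is the bounded contribution of at most one nearby ball, plus that of the others, which is
dominated by the potential of Lebesgue measure on `Q` with density of the order of
`φ(x) ^ (d - 2) n ^ d / l ^ d`, that is, by a constant times `φ(x) ^ (d - 2) n ^ d / l ^ (d - 2)`.
The growth condition, which Harnack chains extend from `|x| ≥ r₀` to the whole ball
(`exists_growth_bound`), says precisely that this is bounded. So the capacity is at least a constant
times `φ(x) ^ (d - 2)` times the number of occupied half cells (`card_mul_le_newtonCap`,
`sum_indicator_le_newtonCap`), and each half cell is occupied with probability `1 - exp (-m)`, where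
its mean measure `m` is at least of the order of `μ(Q) / n ^ d ≤ 1`.

The capacity of the random set is never shown to be measurable: both bounds compare it, almost
surely, with measurable functions of finitely many point counts.
-/

namespace PercolationDiffusion

/-! ### Counts of a Poisson process -/

theorem lintegral_natCast_poissonMeasure (r : ℝ≥0) :
    ∫⁻ k : ℕ, (k : ℝ≥0∞) ∂(poissonMeasure r) = r := by
  rw [poissonMeasure, lintegral_sum_measure]
  have hterm : ∀ n : ℕ, ∫⁻ k : ℕ, (k : ℝ≥0∞)
        ∂(ENNReal.ofReal (Real.exp (-r) * r ^ n / n.factorial) • Measure.dirac n)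
      = ENNReal.ofReal (Real.exp (-r) * r ^ n / n.factorial * n) := by
    intro n
    rw [lintegral_smul_measure, lintegral_dirac, smul_eq_mul, ENNReal.ofReal_mul (by positivity),
      ENNReal.ofReal_natCast]
  simp_rw [hterm]
  rw [tsum_eq_zero_add' ENNReal.summable]
  simp only [CharP.cast_eq_zero, mul_zero, ENNReal.ofReal_zero, zero_add]
  have hshift : ∀ n : ℕ,
      Real.exp (-r) * r ^ (n + 1) / (n + 1).factorial * ((n + 1 : ℕ) : ℝ)
        = r * (Real.exp (-r) * r ^ n / n.factorial) := by
    intro n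
    rw [Nat.factorial_succ]
    push_cast
    field_simp
    ring
  simp_rw [hshift]
  rw [← ENNReal.ofReal_tsum_of_nonneg (fun n => by positivity)
    ((hasSum_one_poissonMeasure r).summable.mul_left _),
    ((hasSum_one_poissonMeasure r).mul_left _).tsum_eq]
  simp

section Poisson

variable {Ω X : Type*} [MeasurableSpace Ω] [MeasurableSpace X] {Pr : Measure Ω} {m : Measure X}
  {P : Ω → Set X}

theorem IsPoissonProcess.lintegral_pointCount (h : IsPoissonProcess Pr m P) {A : Set X}
    (hA : MeasurableSet A) (hm : m A ≠ ∞) :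
    ∫⁻ ω, (pointCount (P ω) A : ℝ≥0∞) ∂Pr = m A := by
  have h1 : ∫⁻ k : ℕ∞, (k : ℝ≥0∞) ∂(Pr.map fun ω => pointCount (P ω) A) =
      ∫⁻ ω, (pointCount (P ω) A : ℝ≥0∞) ∂Pr :=
    lintegral_map .of_discrete (h.measurable_count A hA)
  rw [← h1, h.law_count A hA hm, lintegral_map .of_discrete .of_discrete]
  simp only [ENat.toENNReal_coe]
  rw [lintegral_natCast_poissonMeasure, ENNReal.coe_toNNReal hm]

theorem IsPoissonProcess.measure_pointCount_ne_zero [IsProbabilityMeasure Pr]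
    (h : IsPoissonProcess Pr m P) {A : Set X}
    (hA : MeasurableSet A) (hm : m A ≠ ∞) :
    Pr {ω | pointCount (P ω) A ≠ 0} = ENNReal.ofReal (1 - Real.exp (-(m A).toReal)) := by
  have hmeas := h.measurable_count A hA
  have h0 : Pr {ω | pointCount (P ω) A = 0} = ENNReal.ofReal (Real.exp (-(m A).toReal)) := by
    have h1 : Pr.map (fun ω => pointCount (P ω) A) {0} = Pr {ω | pointCount (P ω) A = 0} :=
      Measure.map_apply hmeas (measurableSet_singleton _)
    rw [← h1, h.law_count A hA hm, Measure.map_apply .of_discrete (measurableSet_singleton _)]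
    have h2 : (fun k : ℕ => (k : ℕ∞)) ⁻¹' {0} = {0} := by ext; simp
    rw [h2, poissonMeasure_singleton]
    simp [ENNReal.coe_toNNReal_eq_toReal]
  have h3 : {ω | pointCount (P ω) A ≠ 0} = {ω | pointCount (P ω) A = 0}ᶜ := rfl
  have h4 : MeasurableSet {ω | pointCount (P ω) A = 0} := hmeas (measurableSet_singleton 0)
  rw [h3, prob_compl_eq_one_sub h4, h0,
    ENNReal.ofReal_sub _ (Real.exp_pos _).le, ENNReal.ofReal_one]

end Poisson

/-! ### Newtonian capacity -/

section Capacity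

variable {d : ℕ}

/-- The potential at the centre of a ball of radius `r` is at least `r ^ (2 - d)` times the mass of
the ball. -/
theorem measure_closedBall_le_of_newtonPotential_le_one (hd : 3 ≤ d) {m : Measure (Space d)}
    {p : Space d} (h : newtonPotential m p ≤ 1) {r : ℝ} (hr : 0 ≤ r) :
    m (Metric.closedBall p r) ≤ ENNReal.ofReal (r ^ (d - 2)) := by
  have hd2 : d - 2 ≠ 0 := by omega
  have h1 : (ENNReal.ofReal r ^ (d - 2))⁻¹ * m (Metric.closedBall p r) ≤ 1 := by
    rw [← setLIntegral_const]
    refine le_trans (le_trans ?_ (setLIntegral_le_lintegral (Metric.closedBall p r) _)) h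
    refine setLIntegral_mono' Metric.isClosed_closedBall.measurableSet fun y hy => ?_
    rw [ENNReal.inv_le_inv]
    gcongr
    rw [edist_dist]
    exact ENNReal.ofReal_le_ofReal (by rw [dist_comm]; exact hy)
  rw [ENNReal.ofReal_pow hr]
  rcases hr.eq_or_lt with rfl | hr'
  -- a ball of radius `0` is a point, at which the kernel is `∞`
  · simp only [ENNReal.ofReal_zero, zero_pow hd2, ENNReal.inv_zero] at h1 ⊢
    by_contra hne
    rw [ENNReal.top_mul (by simpa using hne)] at h1
    simp at h1
  · have h2 : ENNReal.ofReal r ^ (d - 2) ≠ 0 := pow_ne_zero _ (by simpa using hr')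
    have h3 : ENNReal.ofReal r ^ (d - 2) ≠ ∞ := ENNReal.pow_ne_top ENNReal.ofReal_ne_top
    rwa [mul_comm, ← div_eq_mul_inv, ENNReal.div_le_iff h2 h3, one_mul] at h1

/-- Capacity is at most the sum of the capacities of a finite family of covering balls. -/
theorem newtonCap_le_of_subset_biUnion_closedBall (hd : 3 ≤ d) {E : Set (Space d)}
    (s : Finset (Space d)) {φ : Space d → ℝ} (hφ : ∀ p ∈ s, 0 ≤ φ p)
    (hE : E ⊆ ⋃ p ∈ s, Metric.closedBall p (φ p)) :
    newtonCap E ≤ ∑ p ∈ s, ENNReal.ofReal (φ p ^ (d - 2)) := by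
  refine iSup_le fun K => iSup_le fun hK => iSup_le fun _ => iSup_le fun m => iSup_le fun _ =>
    iSup_le fun hm => ?_
  calc m K ≤ m (⋃ p ∈ s, Metric.closedBall p (φ p)) := measure_mono (hK.trans hE)
    _ ≤ ∑ p ∈ s, m (Metric.closedBall p (φ p)) := measure_biUnion_finset_le _ _
    _ ≤ _ := Finset.sum_le_sum fun p hp =>
      measure_closedBall_le_of_newtonPotential_le_one hd (hm p) (hφ p hp)

theorem le_newtonCap {E K : Set (Space d)} (hKE : K ⊆ E) (hK : IsCompact K) {m : Measure (Space d)}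
    (hm : m Kᶜ = 0) (hpot : ∀ x, newtonPotential m x ≤ 1) : m K ≤ newtonCap E :=
  le_iSup_of_le K <| le_iSup_of_le hKE <| le_iSup_of_le hK <| le_iSup_of_le m <|
    le_iSup_of_le hm <| le_iSup_of_le hpot le_rfl

end Capacity

/-! ### Potential of Lebesgue measure on a bounded set -/

section Kernel

variable {d : ℕ}

/-- The volume of the unit ball. -/
noncomputable def unitBallVolume (d : ℕ) : ℝ := volume.real (Metric.ball (0 : Space d) 1)

theorem unitBallVolume_pos : 0 < unitBallVolume d :=
  ENNReal.toReal_pos (Metric.measure_ball_pos _ _ one_pos).ne' measure_ball_lt_top.ne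

theorem volume_ball_eq (x : Space d) {r : ℝ} (hr : 0 < r) :
    volume (Metric.ball x r) = ENNReal.ofReal (unitBallVolume d * r ^ d) := by
  rw [Measure.addHaar_ball_of_pos _ _ hr, mul_comm, ENNReal.ofReal_mul unitBallVolume_pos.le,
    unitBallVolume, ofReal_measureReal measure_ball_lt_top.ne, finrank_euclideanSpace_fin]

theorem volume_closedBall_eq (x : Space d) {r : ℝ} (hr : 0 < r) :
    volume (Metric.closedBall x r) = ENNReal.ofReal (unitBallVolume d * r ^ d) := by
  rw [Measure.addHaar_closedBall _ _ hr.le, mul_comm, ENNReal.ofReal_mul unitBallVolume_pos.le,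
    unitBallVolume, ofReal_measureReal measure_ball_lt_top.ne, finrank_euclideanSpace_fin]

/-- The potential at the centre of a ball, computed in polar coordinates. -/
theorem setLIntegral_kernel_ball (hd : 3 ≤ d) (x : Space d) {R : ℝ} (hR : 0 < R) :
    ∫⁻ y in Metric.ball x R, (edist x y ^ (d - 2))⁻¹ =
      ENNReal.ofReal (d * unitBallVolume d * (R ^ 2 / 2)) := by
  have hd2 : d - 1 = (d - 2) + 1 := by omega
  have : Nontrivial (Space d) := by
    have : Nonempty (Fin d) := ⟨⟨0, by omega⟩⟩
    infer_instance
  set g : ℝ → ℝ := (Set.Iio R).indicator fun r => (r ^ (d - 2))⁻¹ with hg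
  have hdim : Module.finrank ℝ (Space d) = d := finrank_euclideanSpace_fin
  have hgpow : ∀ y ∈ Set.Ioi (0 : ℝ), y ^ (Module.finrank ℝ (Space d) - 1) • g y =
      (Set.Iio R).indicator (fun y => y) y := by
    intro y hy
    have hy' : (0 : ℝ) < y := hy
    by_cases hyR : y < R
    · simp only [hg, Set.indicator, Set.mem_Iio, hyR, if_true, hdim, hd2, smul_eq_mul]
      field_simp
      ring
    · simp [hg, Set.indicator, hyR]
  have hint : IntegrableOn (fun y : ℝ => y ^ (Module.finrank ℝ (Space d) - 1) • g y)
      (Set.Ioi 0) := by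
    rw [integrableOn_congr_fun hgpow measurableSet_Ioi, IntegrableOn,
      integrable_indicator_iff measurableSet_Iio, IntegrableOn,
      Measure.restrict_restrict measurableSet_Iio, Set.Iio_inter_Ioi]
    exact (continuous_id.integrableOn_Icc (a := 0) (b := R)).mono_set Set.Ioo_subset_Icc_self
  have hval : ∫ y in Set.Ioi (0 : ℝ), y ^ (Module.finrank ℝ (Space d) - 1) • g y = R ^ 2 / 2 := by
    rw [setIntegral_congr_fun measurableSet_Ioi hgpow, setIntegral_indicator measurableSet_Iio,
      Set.Ioi_inter_Iio, ← integral_Ioc_eq_integral_Ioo,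
      ← intervalIntegral.integral_of_le hR.le, integral_id]
    ring
  have hInt := (integrable_fun_norm_addHaar (volume : Measure (Space d)) (f := g)).2 hint
  have hVal := integral_fun_norm_addHaar (volume : Measure (Space d)) g
  rw [hval, hdim] at hVal
  have hnonneg : ∀ y : Space d, 0 ≤ g ‖y‖ := fun y =>
    Set.indicator_apply_nonneg fun _ => by positivity
  have h1 : ∫⁻ y in Metric.ball x R, (edist x y ^ (d - 2))⁻¹ =
      ∫⁻ y : Space d, ENNReal.ofReal (g ‖y‖) := by
    rw [← lintegral_indicator measurableSet_ball, ← lintegral_add_left_eq_self _ x]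
    refine lintegral_congr_ae ?_
    filter_upwards [measure_eq_zero_iff_ae_notMem.1
      (measure_singleton (μ := volume) (0 : Space d))] with y hy
    have hy0 : 0 < ‖y‖ := by simpa using hy
    by_cases hyR : ‖y‖ < R
    · have h2 : x + y ∈ Metric.ball x R := by simpa using hyR
      simp only [hg, Set.indicator, h2, if_true, Set.mem_Iio, hyR]
      rw [edist_dist, dist_self_add_right, ENNReal.ofReal_inv_of_pos (by positivity),
        ENNReal.ofReal_pow (norm_nonneg _)]
    · have h2 : x + y ∉ Metric.ball x R := by simpa using hyR
      simp [hg, Set.indicator, h2, hyR]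
  rw [h1, ← ofReal_integral_eq_lintegral_ofReal hInt (ae_of_all _ hnonneg), hVal]
  congr 1
  simp [unitBallVolume, nsmul_eq_mul]
  ring

/-- The constant in the bound of the potential of Lebesgue measure on a bounded set. -/
noncomputable def potentialConst (d : ℕ) : ℝ := (d / 2 + 1) * unitBallVolume d

theorem potentialConst_pos : 0 < potentialConst d := by
  have := unitBallVolume_pos (d := d)
  unfold potentialConst
  positivity

/-- A set with at most the volume of a ball of radius `R` has potential `O(R ^ 2)` everywhere: the
kernel is integrated exactly over the ball of radius `R` about `x`, and is at most `R ^ (2 - d)`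
outside it. -/
theorem setLIntegral_kernel_le (hd : 3 ≤ d) (x : Space d) {R : ℝ} (hR : 0 < R) {F : Set (Space d)}
    (hvol : volume F ≤ ENNReal.ofReal (unitBallVolume d * R ^ d)) :
    ∫⁻ y in F, (edist x y ^ (d - 2))⁻¹ ≤ ENNReal.ofReal (potentialConst d * R ^ 2) := by
  have hv := unitBallVolume_pos (d := d)
  have hd2 : d = (d - 2) + 2 := by omega
  calc ∫⁻ y in F, (edist x y ^ (d - 2))⁻¹
      ≤ ∫⁻ y in F, ((Metric.ball x R).indicator (fun y => (edist x y ^ (d - 2))⁻¹) y +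
          ENNReal.ofReal ((R ^ (d - 2))⁻¹)) := by
        refine lintegral_mono fun y => ?_
        by_cases hy : y ∈ Metric.ball x R
        · simp only [Set.indicator, hy, if_true]
          exact le_self_add
        · simp only [Set.indicator, hy, if_false, zero_add]
          rw [ENNReal.ofReal_inv_of_pos (by positivity), ENNReal.inv_le_inv,
            ENNReal.ofReal_pow hR.le]
          gcongr
          rw [edist_dist, dist_comm]
          exact ENNReal.ofReal_le_ofReal (by simpa using hy)
    _ ≤ (∫⁻ y in Metric.ball x R, (edist x y ^ (d - 2))⁻¹) +
          ENNReal.ofReal ((R ^ (d - 2))⁻¹) * volume F := by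
        rw [lintegral_add_right _ measurable_const, setLIntegral_const,
          ← lintegral_indicator measurableSet_ball]
        gcongr
        exact Measure.restrict_le_self
    _ ≤ ENNReal.ofReal (d * unitBallVolume d * (R ^ 2 / 2)) +
          ENNReal.ofReal ((R ^ (d - 2))⁻¹) * ENNReal.ofReal (unitBallVolume d * R ^ d) := by
        rw [setLIntegral_kernel_ball hd x hR]
        gcongr
    _ = ENNReal.ofReal (potentialConst d * R ^ 2) := by
        rw [← ENNReal.ofReal_mul (by positivity), ← ENNReal.ofReal_add (by positivity)
          (by positivity)]
        congr 1
        have : (R ^ (d - 2))⁻¹ * (unitBallVolume d * R ^ d) = unitBallVolume d * R ^ 2 := by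
          conv_lhs => rw [hd2]
          simp only [Nat.add_sub_cancel]
          rw [pow_add]
          have : R ^ (d - 2) ≠ 0 := by positivity
          rw [← hd2]
          field_simp
        rw [this, potentialConst]
        ring

end Kernel

/-! ### Capacity of a union of separated balls -/

section SeparatedBalls

variable {d : ℕ}

/-- Far from its centre, the potential of a small ball is dominated by that of a larger concentric
ball whose density is scaled down by the ratio of the volumes. -/
theorem setLIntegral_kernel_closedBall_le_of_far {x p : Space d} {σ ρ : ℝ} (hρ : 0 < ρ)
    (hρσ : 2 * ρ ≤ σ) (hx : σ ≤ dist x p) :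
    ∫⁻ y in Metric.closedBall p ρ, (edist x y ^ (d - 2))⁻¹ ≤
      ENNReal.ofReal (4 ^ (d - 2) * ρ ^ d / σ ^ d) *
        ∫⁻ y in Metric.ball p σ, (edist x y ^ (d - 2))⁻¹ := by
  have hv := unitBallVolume_pos (d := d)
  have hσ : 0 < σ := by linarith
  -- the kernel at any point of the small ball is at most `4 ^ (d - 2)` times
  -- the kernel at any point of the large one
  have hk : ∀ y ∈ Metric.closedBall p ρ, ∀ y' ∈ Metric.ball p σ,
      (edist x y ^ (d - 2))⁻¹ ≤ ENNReal.ofReal (4 ^ (d - 2)) * (edist x y' ^ (d - 2))⁻¹ := by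
    intro y hy y' hy'
    rw [Metric.mem_closedBall] at hy
    rw [Metric.mem_ball] at hy'
    have h1 : dist x p ≤ dist x y + dist y p := dist_triangle _ _ _
    have h2 : dist x y' ≤ dist x p + dist y' p := dist_triangle_right _ _ _
    have h3 : dist x y' ≤ 4 * dist x y := by linarith
    have h4 : edist x y' ≤ ENNReal.ofReal 4 * edist x y := by
      rw [edist_dist, edist_dist, ← ENNReal.ofReal_mul (by norm_num)]
      exact ENNReal.ofReal_le_ofReal h3
    have h5 : edist x y' ^ (d - 2) ≤ ENNReal.ofReal (4 ^ (d - 2)) * edist x y ^ (d - 2) := by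
      rw [ENNReal.ofReal_pow (by norm_num), ← mul_pow]
      gcongr
    have h6 : ENNReal.ofReal (4 ^ (d - 2)) ≠ 0 := by simp
    calc (edist x y ^ (d - 2))⁻¹
        = ENNReal.ofReal (4 ^ (d - 2)) *
            (ENNReal.ofReal (4 ^ (d - 2)) * edist x y ^ (d - 2))⁻¹ := by
          rw [ENNReal.mul_inv (Or.inl h6) (Or.inl ENNReal.ofReal_ne_top), ← mul_assoc,
            ENNReal.mul_inv_cancel h6 ENNReal.ofReal_ne_top, one_mul]
      _ ≤ _ := by gcongr
  have hbσ := volume_ball_eq p hσ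
  have hb0 : volume (Metric.ball p σ) ≠ 0 := (Metric.measure_ball_pos _ _ hσ).ne'
  -- average over the large ball
  have h1 : ∀ y ∈ Metric.closedBall p ρ,
      (edist x y ^ (d - 2))⁻¹ ≤ ENNReal.ofReal (4 ^ (d - 2)) / volume (Metric.ball p σ) *
        ∫⁻ y' in Metric.ball p σ, (edist x y' ^ (d - 2))⁻¹ := by
    intro y hy
    rw [ENNReal.div_eq_inv_mul, mul_assoc, ← ENNReal.div_eq_inv_mul,
      ENNReal.le_div_iff_mul_le (Or.inl hb0) (Or.inl measure_ball_lt_top.ne), ← setLIntegral_const,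
      ← lintegral_const_mul' _ _ ENNReal.ofReal_ne_top]
    exact setLIntegral_mono' measurableSet_ball fun y' hy' => hk y hy y' hy'
  calc ∫⁻ y in Metric.closedBall p ρ, (edist x y ^ (d - 2))⁻¹
      ≤ ∫⁻ _ in Metric.closedBall p ρ, ENNReal.ofReal (4 ^ (d - 2)) / volume (Metric.ball p σ) *
        ∫⁻ y' in Metric.ball p σ, (edist x y' ^ (d - 2))⁻¹ :=
        setLIntegral_mono' Metric.isClosed_closedBall.measurableSet h1
    _ = ENNReal.ofReal (4 ^ (d - 2)) / volume (Metric.ball p σ) * volume (Metric.closedBall p ρ) *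
        ∫⁻ y' in Metric.ball p σ, (edist x y' ^ (d - 2))⁻¹ := by
        rw [setLIntegral_const, mul_right_comm]
    _ = _ := by
        rw [hbσ, volume_closedBall_eq p hρ, ← ENNReal.ofReal_div_of_pos (by positivity),
          ← ENNReal.ofReal_mul (by positivity)]
        congr 2
        field_simp

/-- The constant in the lower bound for the capacity of a family of separated balls. -/
noncomputable def capConst (d : ℕ) (B : ℝ) : ℝ :=
  unitBallVolume d / (potentialConst d * (1 + 4 ^ (d - 2) * B))

theorem capConst_pos {B : ℝ} (hB : 0 ≤ B) : 0 < capConst d B := by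
  have := unitBallVolume_pos (d := d)
  have := potentialConst_pos (d := d)
  unfold capConst
  positivity

/-- The capacity of a family of equal balls of radius `ρ` is at least a constant times the sum of
their capacities, if their centres are the centres of disjoint balls of radius `σ` in a ball of
radius `R` and `ρ ^ (d - 2) R ^ 2 ≤ B σ ^ d`. The equilibrium measure is replaced by a multiple of
Lebesgue measure on the balls; away from the nearest ball, its potential is dominated by that of
Lebesgue measure on the ball of radius `R`, with density of order `(ρ / σ) ^ d`. -/
theorem card_mul_le_newtonCap (hd : 3 ≤ d) {ι : Type*} (s : Finset ι) (p : ι → Space d)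
    {σ ρ R B : ℝ} (hρ : 0 < ρ) (hρσ : 2 * ρ ≤ σ)
    (hdisj : (s : Set ι).PairwiseDisjoint fun i => Metric.ball (p i) σ)
    (z : Space d) (hR : 0 < R) (hsub : ∀ i ∈ s, Metric.ball (p i) σ ⊆ Metric.ball z R)
    (hB0 : 0 ≤ B) (hB : ρ ^ (d - 2) * R ^ 2 ≤ B * σ ^ d)
    {E : Set (Space d)} (hE : ∀ i ∈ s, Metric.closedBall (p i) ρ ⊆ E) :
    s.card * ENNReal.ofReal (capConst d B * ρ ^ (d - 2)) ≤ newtonCap E := by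
  classical
  have hv := unitBallVolume_pos (d := d)
  have ha := potentialConst_pos (d := d)
  have hσ : 0 < σ := by linarith
  have hd2 : ρ ^ d = ρ ^ (d - 2) * ρ ^ 2 := by rw [← pow_add]; congr 1; omega
  -- the density for which the bound obtained below for the potential is exactly `1`
  set t : ℝ := 1 / (potentialConst d * (1 + 4 ^ (d - 2) * B) * ρ ^ 2) with ht
  have ht0 : 0 < t := by positivity
  set κ : Set (Space d) := ⋃ i ∈ s, Metric.closedBall (p i) ρ with hκ
  set m : Measure (Space d) :=
    ∑ i ∈ s, ENNReal.ofReal t • volume.restrict (Metric.closedBall (p i) ρ) with hm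
  have hκcomp : IsCompact κ := s.isCompact_biUnion fun i _ => isCompact_closedBall _ _
  have hκE : κ ⊆ E := Set.iUnion₂_subset hE
  have hκsub : ∀ i ∈ s, Metric.closedBall (p i) ρ ⊆ κ := fun i hi =>
    Set.subset_biUnion_of_mem (u := fun i => Metric.closedBall (p i) ρ) hi
  have hκmeas : MeasurableSet κ := hκcomp.measurableSet
  have hmκ : m κᶜ = 0 := by
    rw [hm, Measure.finsetSum_apply]
    refine Finset.sum_eq_zero fun i hi => ?_
    rw [Measure.smul_apply, Measure.restrict_apply hκmeas.compl]
    have : κᶜ ∩ Metric.closedBall (p i) ρ = ∅ := by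
      rw [← Set.disjoint_iff_inter_eq_empty, Set.disjoint_compl_left_iff_subset]
      exact hκsub i hi
    simp [this]
  have hmass : m κ = s.card * ENNReal.ofReal (capConst d B * ρ ^ (d - 2)) := by
    rw [hm, Measure.finsetSum_apply, ← nsmul_eq_mul]
    refine Finset.sum_eq_card_nsmul fun i hi => ?_
    rw [Measure.smul_apply, Measure.restrict_apply hκmeas,
      Set.inter_eq_self_of_subset_right (hκsub i hi), volume_closedBall_eq _ hρ, smul_eq_mul,
      ← ENNReal.ofReal_mul ht0.le]
    congr 1
    rw [ht, capConst, hd2]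
    field_simp
  rw [← hmass]
  refine le_newtonCap hκE hκcomp hmκ fun x => ?_
  have hpot : newtonPotential m x = ENNReal.ofReal t *
      ∑ i ∈ s, ∫⁻ y in Metric.closedBall (p i) ρ, (edist x y ^ (d - 2))⁻¹ := by
    rw [newtonPotential, hm, lintegral_finsetSum_measure, Finset.mul_sum]
    simp_rw [lintegral_smul_measure, smul_eq_mul]
  set L : ℝ≥0∞ := ENNReal.ofReal (4 ^ (d - 2) * ρ ^ d / σ ^ d) with hL
  -- `x` is close to at most one centre; the other balls are compared with larger disjoint balls
  have hterm : ∀ i ∈ s, ∫⁻ y in Metric.closedBall (p i) ρ, (edist x y ^ (d - 2))⁻¹ ≤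
      (if dist x (p i) < σ then ENNReal.ofReal (potentialConst d * ρ ^ 2) else 0) +
        L * ∫⁻ y in Metric.ball (p i) σ, (edist x y ^ (d - 2))⁻¹ := by
    intro i _
    split_ifs with hi
    · exact le_add_right (setLIntegral_kernel_le hd x hρ (volume_closedBall_eq _ hρ).le)
    · rw [zero_add]
      exact setLIntegral_kernel_closedBall_le_of_far hρ hρσ (not_lt.1 hi)
  have hnear : ∑ i ∈ s, (if dist x (p i) < σ then ENNReal.ofReal (potentialConst d * ρ ^ 2)
      else 0) ≤ ENNReal.ofReal (potentialConst d * ρ ^ 2) := by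
    rw [← Finset.sum_filter, Finset.sum_const, nsmul_eq_mul]
    have hcard : (s.filter fun i => dist x (p i) < σ).card ≤ 1 := by
      refine Finset.card_le_one.2 fun i hi j hj => ?_
      rw [Finset.mem_filter] at hi hj
      by_contra hij
      exact Set.disjoint_left.1 (hdisj hi.1 hj.1 hij) (Metric.mem_ball.2 hi.2)
        (Metric.mem_ball.2 hj.2)
    calc _ ≤ ((1 : ℕ) : ℝ≥0∞) * ENNReal.ofReal (potentialConst d * ρ ^ 2) := by gcongr
      _ = _ := by simp
  have hfar : ∑ i ∈ s, ∫⁻ y in Metric.ball (p i) σ, (edist x y ^ (d - 2))⁻¹ ≤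
      ENNReal.ofReal (potentialConst d * R ^ 2) := by
    rw [← lintegral_biUnion_finset hdisj fun i _ => measurableSet_ball]
    refine le_trans (lintegral_mono_set (Set.iUnion₂_subset hsub)) ?_
    exact setLIntegral_kernel_le hd x hR (volume_ball_eq _ hR).le
  calc newtonPotential m x
      ≤ ENNReal.ofReal t * (ENNReal.ofReal (potentialConst d * ρ ^ 2) +
          L * ENNReal.ofReal (potentialConst d * R ^ 2)) := by
        rw [hpot]
        gcongr
        refine (Finset.sum_le_sum hterm).trans ?_
        rw [Finset.sum_add_distrib, ← Finset.mul_sum]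
        gcongr
    _ = ENNReal.ofReal (t * (potentialConst d * ρ ^ 2 +
          4 ^ (d - 2) * ρ ^ d / σ ^ d * (potentialConst d * R ^ 2))) := by
        rw [hL, ← ENNReal.ofReal_mul (by positivity), ← ENNReal.ofReal_add (by positivity)
          (by positivity), ← ENNReal.ofReal_mul ht0.le]
    _ ≤ 1 := by
        rw [ENNReal.ofReal_le_one]
        have h1 : 4 ^ (d - 2) * ρ ^ d / σ ^ d * (potentialConst d * R ^ 2) ≤
            potentialConst d * ρ ^ 2 * (4 ^ (d - 2) * B) := by
          rw [hd2, div_mul_eq_mul_div, div_le_iff₀ (by positivity)]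
          calc 4 ^ (d - 2) * (ρ ^ (d - 2) * ρ ^ 2) * (potentialConst d * R ^ 2)
              = 4 ^ (d - 2) * ρ ^ 2 * potentialConst d * (ρ ^ (d - 2) * R ^ 2) := by ring
            _ ≤ 4 ^ (d - 2) * ρ ^ 2 * potentialConst d * (B * σ ^ d) := by gcongr
            _ = _ := by ring
        calc t * (potentialConst d * ρ ^ 2 +
              4 ^ (d - 2) * ρ ^ d / σ ^ d * (potentialConst d * R ^ 2))
            ≤ t * (potentialConst d * ρ ^ 2 + potentialConst d * ρ ^ 2 * (4 ^ (d - 2) * B)) := by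
              gcongr
          _ = 1 := by rw [ht]; field_simp

end SeparatedBalls

/-! ### Cubes, Whitney cubes and Harnack chains -/

section Geometry

variable {d : ℕ}

theorem cube_eq_preimage (a : Space d) (l : ℝ) :
    cube a l = WithLp.ofLp ⁻¹' Set.Icc (WithLp.ofLp a) (fun i => a i + l) := by
  ext x
  simp [cube, Pi.le_def, forall_and]

theorem measurableSet_cube (a : Space d) (l : ℝ) : MeasurableSet (cube a l) := by
  rw [cube_eq_preimage]
  exact (PiLp.volume_preserving_ofLp (Fin d)).measurable measurableSet_Icc

theorem volume_cube (a : Space d) {l : ℝ} (hl : 0 ≤ l) :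
    volume (cube a l) = ENNReal.ofReal (l ^ d) := by
  rw [cube_eq_preimage, (PiLp.volume_preserving_ofLp (Fin d)).measure_preimage
    measurableSet_Icc.nullMeasurableSet, Real.volume_Icc_pi]
  simp [ENNReal.ofReal_pow hl]

theorem abs_coord_sub_le_dist (x y : Space d) (i : Fin d) : |x i - y i| ≤ dist x y := by
  rw [dist_eq_norm, ← Real.norm_eq_abs]
  exact PiLp.norm_apply_le (x - y) i

theorem dist_le_of_mem_cube {a x y : Space d} {l : ℝ} (hl : 0 ≤ l) (hx : x ∈ cube a l)
    (hy : y ∈ cube a l) : dist x y ≤ d * l := by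
  rcases Nat.eq_zero_or_pos d with rfl | hd
  · simp [Subsingleton.elim x y]
  have h1 : ∀ i ∈ Finset.univ, dist (x i) (y i) ^ 2 ≤ l ^ 2 := by
    intro i _
    rw [Real.dist_eq, sq_abs]
    have := hx i
    have := hy i
    exact sq_le_sq' (by linarith) (by linarith)
  rw [EuclideanSpace.dist_eq]
  refine Real.sqrt_le_iff.2 ⟨by positivity, (Finset.sum_le_sum h1).trans ?_⟩
  simp only [Finset.sum_const, Finset.card_univ, Fintype.card_fin, nsmul_eq_mul]
  have : (1 : ℝ) ≤ d := by exact_mod_cast hd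
  nlinarith [sq_nonneg l, mul_nonneg (sub_nonneg.2 this) (sq_nonneg l)]

theorem exists_mem_unitSphere_dist_eq (hd : 3 ≤ d) {x : Space d} (hx : ‖x‖ < 1) :
    ∃ y ∈ unitSphere d, dist x y = 1 - ‖x‖ := by
  rcases eq_or_ne x 0 with rfl | hx0
  · refine ⟨EuclideanSpace.single ⟨0, by omega⟩ 1, by simp [unitSphere], by simp⟩
  · have h0 : ‖x‖ ≠ 0 := norm_ne_zero_iff.2 hx0
    refine ⟨‖x‖⁻¹ • x, by simp [unitSphere, norm_smul, h0], ?_⟩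
    have h1 : x - ‖x‖⁻¹ • x = (1 - ‖x‖⁻¹) • x := by rw [sub_smul, one_smul]
    have h2 : 1 ≤ ‖x‖⁻¹ := (one_le_inv₀ (norm_pos_iff.2 hx0)).2 hx.le
    rw [dist_eq_norm, h1, norm_smul, Real.norm_eq_abs, abs_of_nonpos (by linarith)]
    field_simp
    ring

/-- A Whitney cube of sidelength `l` lies at distance comparable to `l` from the sphere. -/
theorem IsWhitneyCube.exists_cube (hd : 3 ≤ d) {Q : Set (Space d)} (hQ : IsWhitneyCube Q) :
    ∃ (a : Space d) (l : ℝ), 0 < l ∧ Q = cube a l ∧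
      ∀ y ∈ Q, l ≤ 1 - ‖y‖ ∧ 1 - ‖y‖ ≤ 5 * d * l := by
  obtain ⟨⟨a, l, hl, rfl⟩, hball, hlow, hup⟩ := hQ
  refine ⟨a, l, hl, rfl, fun y hy => ?_⟩
  have hnorm : ∀ z ∈ cube a l, ‖z‖ < 1 := fun z hz => by simpa [unitBall] using hball hz
  have hbdd : Bornology.IsBounded (cube a l) := Metric.isBounded_ball.subset hball
  have hdiam : Metric.diam (cube a l) ≤ d * l :=
    Metric.diam_le_of_forall_dist_le (by positivity) fun x hx y hy =>
      dist_le_of_mem_cube hl.le hx hy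
  have hldiam : l ≤ Metric.diam (cube a l) := by
    have h1 : a ∈ cube a l := fun i => ⟨le_rfl, by linarith⟩
    have h2 : (WithLp.toLp 2 fun i => a i + l : Space d) ∈ cube a l :=
      fun i => ⟨by simp [hl.le], by simp⟩
    have h3 := Metric.dist_le_diam_of_mem hbdd h2 h1
    have h4 := abs_coord_sub_le_dist (WithLp.toLp 2 fun i => a i + l : Space d) a ⟨0, by omega⟩
    simp only [add_sub_cancel_left, abs_of_pos hl] at h4
    linarith
  constructor
  · obtain ⟨w, hw, hdist⟩ := exists_mem_unitSphere_dist_eq hd (hnorm y hy)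
    have h1 : setDist (cube a l) (unitSphere d) ≤ 1 - ‖y‖ :=
      csInf_le ⟨0, by rintro r ⟨_, _, _, _, rfl⟩; exact dist_nonneg⟩ ⟨y, hy, w, hw, hdist.symm⟩
    linarith
  · obtain ⟨w, hw, hdist⟩ := exists_mem_unitSphere_dist_eq hd (hnorm y hy)
    have h1 : 1 - ‖y‖ - Metric.diam (cube a l) ≤ setDist (cube a l) (unitSphere d) := by
      refine le_csInf ⟨_, y, hy, w, hw, rfl⟩ ?_
      rintro r ⟨z, hz, u, hu, rfl⟩
      have h2 : ‖u‖ = 1 := by simpa [unitSphere] using hu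
      have h3 : ‖u‖ - ‖z‖ ≤ ‖u - z‖ := norm_sub_norm_le _ _
      rw [← dist_eq_norm, dist_comm] at h3
      have h4 : ‖z‖ - ‖y‖ ≤ ‖z - y‖ := norm_sub_norm_le _ _
      rw [← dist_eq_norm] at h4
      have h5 := Metric.dist_le_diam_of_mem hbdd hz hy
      linarith
    linarith

/-- A function that varies by at most a factor `C` at the scale of the distance to the sphere
varies by at most a factor `C ^ N` between two points that are joined by a segment of length less
than `N h / 2` and stay at distance `h` from the sphere. -/
theorem le_pow_mul_of_dist_lt {f : Space d → ℝ} {C : ℝ} (hC : 0 ≤ C)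
    (hf : ∀ x ∈ unitBall d, ∀ y ∈ Metric.ball x ((1 - ‖x‖) / 2), f y ≤ C * f x)
    {h : ℝ} (hh : 0 < h) (N : ℕ) :
    ∀ x y : Space d, h ≤ 1 - ‖x‖ → h ≤ 1 - ‖y‖ → dist x y < N * (h / 2) →
      f y ≤ C ^ N * f x := by
  induction N with
  | zero =>
    intro x y _ _ hxy
    simp at hxy
    exact absurd hxy (not_lt.2 dist_nonneg)
  | succ N ih =>
    intro x y hx hy hxy
    push_cast at hxy
    have hN : (0 : ℝ) < N + 1 := by positivity
    rcases Nat.eq_zero_or_pos N with rfl | hN0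
    · have h1 : y ∈ Metric.ball x ((1 - ‖x‖) / 2) := by
        rw [Metric.mem_ball, dist_comm]
        simp at hxy
        linarith
      simpa using hf x (by simp [unitBall]; linarith) y h1
    have hN1 : (0 : ℝ) < N := by exact_mod_cast hN0
    -- the point at distance `|x - y| / (N + 1)` from `y` on the segment
    set θ : ℝ := N / (N + 1) with hθ
    have hθ0 : 0 ≤ θ := by positivity
    have hθ1 : 1 - θ = 1 / (N + 1) := by rw [hθ]; field_simp; ring
    have hθ1' : 0 ≤ 1 - θ := by rw [hθ1]; positivity
    set z : Space d := AffineMap.lineMap x y θ with hz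
    have hz1 : dist x z = θ * dist x y := by
      rw [hz, dist_left_lineMap, Real.norm_eq_abs, abs_of_nonneg hθ0]
    have hz2 : dist z y = (1 - θ) * dist x y := by
      rw [hz, dist_lineMap_right, Real.norm_eq_abs, abs_of_nonneg hθ1']
    have hz3 : h ≤ 1 - ‖z‖ := by
      have h1 : z = (1 - θ) • x + θ • y := by rw [hz, AffineMap.lineMap_apply_module]
      have h2 : ‖z‖ ≤ (1 - θ) * ‖x‖ + θ * ‖y‖ := by
        rw [h1]
        refine (norm_add_le _ _).trans ?_
        rw [norm_smul, norm_smul, Real.norm_eq_abs, Real.norm_eq_abs, abs_of_nonneg hθ0,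
          abs_of_nonneg hθ1']
      nlinarith
    have hxz : dist x z < N * (h / 2) := by
      rw [hz1, hθ, div_mul_eq_mul_div, div_lt_iff₀ hN]
      nlinarith
    have hzy : dist z y < h / 2 := by
      rw [hz2, hθ1, div_mul_eq_mul_div, div_lt_iff₀ hN]
      nlinarith
    have h1 := ih x z hx hz3 hxz
    have h2 := hf z (by simp [unitBall]; linarith) y (by
      rw [Metric.mem_ball, dist_comm]; linarith)
    calc f y ≤ C * f z := h2
      _ ≤ C * (C ^ N * f x) := by gcongr
      _ = _ := by ring

end Geometry

/-! ### The mean measure -/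

section MeanMeasure

variable {d : ℕ}

theorem meanMeasure_apply {ν : Space d → ℝ} {A : Set (Space d)} (hA : MeasurableSet A)
    (hAB : A ⊆ unitBall d) : meanMeasure ν A = ∫⁻ x in A, ENNReal.ofReal (ν x) := by
  rw [meanMeasure, withDensity_apply _ hA, Measure.restrict_restrict hA,
    Set.inter_eq_self_of_subset_left hAB]

theorem meanMeasure_le {ν : Space d → ℝ} {A : Set (Space d)} (hA : MeasurableSet A)
    (hAB : A ⊆ unitBall d) {b : ℝ} (hb : ∀ x ∈ A, ν x ≤ b) :
    meanMeasure ν A ≤ ENNReal.ofReal b * volume A := by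
  rw [meanMeasure_apply hA hAB, ← setLIntegral_const]
  exact setLIntegral_mono' hA fun x hx => ENNReal.ofReal_le_ofReal (hb x hx)

theorem le_meanMeasure {ν : Space d → ℝ} {A : Set (Space d)} (hA : MeasurableSet A)
    (hAB : A ⊆ unitBall d) {b : ℝ} (hb : ∀ x ∈ A, b ≤ ν x) :
    ENNReal.ofReal b * volume A ≤ meanMeasure ν A := by
  rw [meanMeasure_apply hA hAB, ← setLIntegral_const]
  exact setLIntegral_mono' hA fun x hx => ENNReal.ofReal_le_ofReal (hb x hx)

theorem meanMeasure_compl_unitBall (ν : Space d → ℝ) : meanMeasure ν (unitBall d)ᶜ = 0 := by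
  have hB : MeasurableSet (unitBall d) := measurableSet_ball
  rw [meanMeasure, withDensity_apply _ hB.compl, Measure.restrict_restrict hB.compl]
  simp

end MeanMeasure

/-- The functions `φ` and `ν` differ by at most a factor `M` from their values at `x` on the points
within `R l` of `x` that stay at distance `l / 2` from the unit sphere. -/
def ComparableNear {d : ℕ} (φ ν : Space d → ℝ) (x : Space d) (l R M : ℝ) : Prop :=
  ∀ p, dist x p ≤ R * l → l / 2 ≤ 1 - ‖p‖ →
    (φ p ≤ M * φ x ∧ φ x ≤ M * φ p) ∧ (ν p ≤ M * ν x ∧ ν x ≤ M * ν p)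

/-! ### Upper bound for the mean capacity -/

section UpperBound

variable {d : ℕ} {φ ν : Space d → ℝ} {c l : ℝ} {a x : Space d} {M : ℝ}

/-- The radius, in units of the sidelength of a Whitney cube, within which lie the centres of all
balls of the archipelago that meet the cube. -/
noncomputable def reach (d : ℕ) (c : ℝ) : ℝ := d * (1 + 5 * c / (1 - c))

theorem natCast_le_reach (hc0 : 0 ≤ c) (hc1 : c < 1) : (d : ℝ) ≤ reach d c := by
  have h1 : 0 ≤ 5 * c / (1 - c) := div_nonneg (by positivity) (by linarith)
  have h2 : (0 : ℝ) ≤ d := by positivity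
  unfold reach
  nlinarith

/-- If the ball about `p` of radius `φ p ≤ c (1 - |p|)` meets a Whitney cube, then `p` lies within
`reach d c` sidelengths of the points of the cube, and not much closer to the unit sphere: since
`c < 1`, `1 - |p|` is at most `(1 - |y|) / (1 - c)` for a point `y` in both sets. -/
theorem dist_le_reach_mul (hc0 : 0 ≤ c) (hc1 : c < 1) (hl : 0 < l)
    (hQ : ∀ y ∈ cube a l, l ≤ 1 - ‖y‖ ∧ 1 - ‖y‖ ≤ 5 * d * l) (hx : x ∈ cube a l)
    {p y : Space d} (hp : φ p ≤ c * (1 - ‖p‖)) (hy : y ∈ cube a l)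
    (hyp : dist y p ≤ φ p) : dist x p ≤ reach d c * l ∧ l / 2 ≤ 1 - ‖p‖ := by
  obtain ⟨h1, h2⟩ := hQ y hy
  have h3 : ‖y‖ - ‖p‖ ≤ dist y p := by rw [dist_eq_norm]; exact norm_sub_norm_le _ _
  have h4 : ‖p‖ - ‖y‖ ≤ dist y p := by
    rw [dist_comm, dist_eq_norm]; exact norm_sub_norm_le _ _
  have h5 := dist_triangle x y p
  have h6 := dist_le_of_mem_cube hl.le hx hy
  have hc2 : 0 < 1 - c := by linarith
  have h7 : 1 - ‖p‖ ≤ 5 * d * l / (1 - c) := by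
    rw [le_div_iff₀ hc2]
    nlinarith
  have h8 : c * (1 - ‖p‖) ≤ c * (5 * d * l / (1 - c)) := by gcongr
  have h9 : reach d c * l = d * l + c * (5 * d * l / (1 - c)) := by
    rw [reach]
    field_simp
  constructor
  · linarith
  · nlinarith

/-- The mean capacity is at most the mean number of balls that can meet the cube times the largest
possible capacity of such a ball, and both are controlled by the comparability of `φ` and `ν`. The
integrand need not be measurable, but the bounding count is. -/
theorem lintegral_newtonCap_le (hd : 3 ≤ d) (hc0 : 0 ≤ c) (hc1 : c < 1) (hl : 0 < l)
    (hφ0 : ∀ y ∈ unitBall d, 0 ≤ φ y) (hν0 : ∀ y ∈ unitBall d, 0 ≤ ν y)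
    (hφc : ∀ y ∈ unitBall d, φ y ≤ c * (1 - ‖y‖))
    (hQ : ∀ y ∈ cube a l, l ≤ 1 - ‖y‖ ∧ 1 - ‖y‖ ≤ 5 * d * l) (hx : x ∈ cube a l)
    (hM0 : 0 < M) (hM : ComparableNear φ ν x l (reach d c) M)
    {Ω : Type*} [MeasurableSpace Ω] {Pr : Measure Ω} {P : Ω → Set (Space d)}
    (hP : IsPoissonProcess Pr (meanMeasure ν) P) :
    ∫⁻ ω, newtonCap (archipelago φ (P ω) ∩ cube a l) ∂Pr ≤
      ENNReal.ofReal (M ^ d * unitBallVolume d * reach d c ^ d * φ x ^ (d - 2)) *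
        meanMeasure ν (cube a l) := by
  classical
  have hv := unitBallVolume_pos (d := d)
  have hdR := natCast_le_reach (d := d) hc0 hc1
  have hd1 : (3 : ℝ) ≤ d := by exact_mod_cast hd
  have hR : 0 < reach d c := by linarith
  have hQball : cube a l ⊆ unitBall d := fun y hy => by
    have := hQ y hy
    simp only [unitBall, Metric.mem_ball, dist_zero_right]
    linarith
  have hxν := hν0 x (hQball hx)
  have hxφ := hφ0 x (hQball hx)
  -- the centres of the balls that meet the cube
  set A : Set (Space d) := Metric.closedBall x (reach d c * l) ∩ {p | ‖p‖ ≤ 1 - l / 2} with hA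
  have hAmem : ∀ p ∈ A, dist x p ≤ reach d c * l ∧ l / 2 ≤ 1 - ‖p‖ := by
    rintro p ⟨h1, h2⟩
    rw [Metric.mem_closedBall, dist_comm] at h1
    rw [Set.mem_ofPred_eq] at h2
    exact ⟨h1, by linarith⟩
  have hAmeas : MeasurableSet A :=
    Metric.isClosed_closedBall.measurableSet.inter
      (isClosed_le continuous_norm continuous_const).measurableSet
  have hAball : A ⊆ unitBall d := fun p hp => by
    have := (hAmem p hp).2
    simp only [unitBall, Metric.mem_ball, dist_zero_right]
    linarith
  have hAle : meanMeasure ν A ≤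
      ENNReal.ofReal (M * ν x * (unitBallVolume d * (reach d c * l) ^ d)) := by
    refine (meanMeasure_le hAmeas hAball fun p hp =>
      (hM p (hAmem p hp).1 (hAmem p hp).2).2.1).trans ?_
    have hRl : 0 < reach d c * l := by positivity
    rw [ENNReal.ofReal_mul (p := M * ν x) (by positivity), ← volume_closedBall_eq x hRl]
    gcongr
    exact Set.inter_subset_left
  have hAfin : meanMeasure ν A ≠ ∞ := (hAle.trans_lt ENNReal.ofReal_lt_top).ne
  have hQge : ENNReal.ofReal (ν x / M * l ^ d) ≤ meanMeasure ν (cube a l) := by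
    rw [ENNReal.ofReal_mul (by positivity), ← volume_cube a hl.le]
    refine le_meanMeasure (measurableSet_cube a l) hQball fun y hy => ?_
    rw [div_le_iff₀ hM0, mul_comm]
    refine (hM y ?_ ?_).2.2
    · exact (dist_le_of_mem_cube hl.le hx hy).trans (by gcongr)
    · linarith [hQ y hy]
  have hcount := hP.lintegral_pointCount hAmeas hAfin
  have hae1 : ∀ᵐ ω ∂Pr, (pointCount (P ω) A : ℝ≥0∞) < ∞ :=
    ae_lt_top (Measurable.of_discrete.comp (hP.measurable_count A hAmeas)) (by rwa [hcount])
  have hBc : MeasurableSet (unitBall d)ᶜ := measurableSet_ball.compl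
  -- almost surely all points lie in the unit ball, outside which `φ` is arbitrary
  have hcountc := hP.lintegral_pointCount hBc (by simp [meanMeasure_compl_unitBall])
  have hmeasc : Measurable fun ω => (pointCount (P ω) (unitBall d)ᶜ : ℝ≥0∞) :=
    Measurable.of_discrete.comp (hP.measurable_count _ hBc)
  rw [meanMeasure_compl_unitBall, lintegral_eq_zero_iff hmeasc] at hcountc
  have hptw : ∀ᵐ ω ∂Pr, newtonCap (archipelago φ (P ω) ∩ cube a l) ≤
      ENNReal.ofReal ((M * φ x) ^ (d - 2)) * (pointCount (P ω) A : ℝ≥0∞) := by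
    filter_upwards [hae1, hcountc] with ω h1 h2
    have h3 : P ω ∩ (unitBall d)ᶜ = ∅ := by simpa [pointCount] using h2
    have h4 : (P ω ∩ A).Finite := by
      rw [← Set.encard_lt_top_iff]
      simpa [pointCount] using h1
    have h5 : archipelago φ (P ω) ∩ cube a l ⊆
        ⋃ p ∈ h4.toFinset, Metric.closedBall p (φ p) := by
      rintro y ⟨hy, hyQ⟩
      obtain ⟨p, hp, hyp⟩ := Set.mem_iUnion₂.1 hy
      have hpB : p ∈ unitBall d := by
        by_contra hpB
        exact Set.eq_empty_iff_forall_notMem.1 h3 p ⟨hp, hpB⟩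
      obtain ⟨h6, h7⟩ := dist_le_reach_mul hc0 hc1 hl hQ hx (hφc p hpB) hyQ
        (Metric.mem_closedBall.1 hyp)
      refine Set.mem_iUnion₂.2 ⟨p, ?_, hyp⟩
      rw [Set.Finite.mem_toFinset]
      refine ⟨hp, ?_, ?_⟩
      · rwa [Metric.mem_closedBall, dist_comm]
      · rw [Set.mem_ofPred_eq]
        linarith
    have hmemA : ∀ p ∈ h4.toFinset, p ∈ A := fun p hp => (h4.mem_toFinset.1 hp).2
    calc newtonCap (archipelago φ (P ω) ∩ cube a l)
        ≤ ∑ p ∈ h4.toFinset, ENNReal.ofReal (φ p ^ (d - 2)) :=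
          newtonCap_le_of_subset_biUnion_closedBall hd _
            (fun p hp => hφ0 p (hAball (hmemA p hp))) h5
      _ ≤ ∑ _p ∈ h4.toFinset, ENNReal.ofReal ((M * φ x) ^ (d - 2)) := by
          refine Finset.sum_le_sum fun p hp => ENNReal.ofReal_le_ofReal ?_
          have h6 := hAmem p (hmemA p hp)
          exact pow_le_pow_left₀ (hφ0 p (hAball (hmemA p hp))) (hM p h6.1 h6.2).1.1 _
      _ = _ := by
          rw [Finset.sum_const, nsmul_eq_mul, mul_comm, pointCount, h4.encard_eq_coe_toFinset_card,
            ENat.toENNReal_coe]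
  calc ∫⁻ ω, newtonCap (archipelago φ (P ω) ∩ cube a l) ∂Pr
      ≤ ∫⁻ ω, ENNReal.ofReal ((M * φ x) ^ (d - 2)) * (pointCount (P ω) A : ℝ≥0∞) ∂Pr :=
        lintegral_mono_ae hptw
    _ = ENNReal.ofReal ((M * φ x) ^ (d - 2)) * meanMeasure ν A := by
        rw [lintegral_const_mul' _ _ ENNReal.ofReal_ne_top, hcount]
    _ ≤ ENNReal.ofReal ((M * φ x) ^ (d - 2)) *
          ENNReal.ofReal (M * ν x * (unitBallVolume d * (reach d c * l) ^ d)) := by gcongr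
    _ = ENNReal.ofReal (M ^ d * unitBallVolume d * reach d c ^ d * φ x ^ (d - 2)) *
          ENNReal.ofReal (ν x / M * l ^ d) := by
        rw [← ENNReal.ofReal_mul (by positivity), ← ENNReal.ofReal_mul (by positivity)]
        have hMd : M ^ d = M ^ (d - 2) * M ^ 2 := by rw [← pow_add]; congr 1; omega
        congr 1
        rw [hMd, mul_pow M (φ x), mul_pow (reach d c) l]
        field_simp
    _ ≤ _ := by gcongr

end UpperBound

/-! ### Lower bound for the mean capacity -/

section LowerBound

variable {d : ℕ}

/-- The concentric half-size subcube of the cell with index `k` in the division of the cube with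
lower corner `a` into cells of sidelength `s`. -/
noncomputable def halfCell (a : Space d) (s : ℝ) {n : ℕ} (k : Fin d → Fin n) : Set (Space d) :=
  cube (WithLp.toLp 2 fun i => a i + s * (k i : ℕ) + s / 4) (s / 2)

theorem mem_halfCell {a p : Space d} {s : ℝ} {n : ℕ} {k : Fin d → Fin n} :
    p ∈ halfCell a s k ↔ ∀ i, a i + s * (k i : ℕ) + s / 4 ≤ p i ∧
      p i ≤ a i + s * (k i : ℕ) + s / 4 + s / 2 := Iff.rfl

theorem ball_subset_cube_of_mem_halfCell {a p : Space d} {s : ℝ} (hs : 0 < s) {n : ℕ}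
    {k : Fin d → Fin n} (hp : p ∈ halfCell a s k) : Metric.ball p (s / 4) ⊆ cube a (n * s) := by
  intro y hy i
  have h1 := abs_le.1 ((abs_coord_sub_le_dist y p i).trans (Metric.mem_ball.1 hy).le)
  have h2 := mem_halfCell.1 hp i
  have h3 : ((k i : ℕ) : ℝ) + 1 ≤ n := by exact_mod_cast (k i).2
  have h4 : 0 ≤ s * (k i : ℕ) := by positivity
  have h5 : s * ((k i : ℕ) + 1) ≤ s * n := by gcongr
  constructor <;> linarith

theorem disjoint_ball_of_mem_halfCell {a p q : Space d} {s : ℝ} (hs : 0 < s) {n : ℕ}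
    {k j : Fin d → Fin n} (hkj : k ≠ j) (hp : p ∈ halfCell a s k) (hq : q ∈ halfCell a s j) :
    Disjoint (Metric.ball p (s / 4)) (Metric.ball q (s / 4)) := by
  obtain ⟨i, hi⟩ := Function.ne_iff.1 hkj
  refine Metric.ball_disjoint_ball (le_trans ?_ (abs_coord_sub_le_dist p q i))
  have h1 := mem_halfCell.1 hp i
  have h2 := mem_halfCell.1 hq i
  have hne : (k i : ℕ) ≠ (j i : ℕ) := fun h => hi (Fin.ext h)
  rcases lt_or_gt_of_ne hne with h | h
  · have h3 : ((k i : ℕ) : ℝ) + 1 ≤ (j i : ℕ) := by exact_mod_cast h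
    have h4 : s * ((k i : ℕ) + 1) ≤ s * (j i : ℕ) := by gcongr
    rw [abs_sub_comm]
    exact le_trans (by linarith) (le_abs_self _)
  · have h3 : ((j i : ℕ) : ℝ) + 1 ≤ (k i : ℕ) := by exact_mod_cast h
    have h4 : s * ((j i : ℕ) + 1) ≤ s * (k i : ℕ) := by gcongr
    exact le_trans (by linarith) (le_abs_self _)

/-- The least positive `n` with `r ≤ n ^ d`: either `n = 1`, or `n ≤ 2 (n - 1)` and
`(n - 1) ^ d < r`. -/
theorem exists_nat_pow_comparable (hd : d ≠ 0) {r : ℝ} (hr : 0 ≤ r) :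
    ∃ n : ℕ, 1 ≤ n ∧ r ≤ (n : ℝ) ^ d ∧ (n : ℝ) ^ d ≤ 1 + 2 ^ d * r := by
  classical
  have hex : ∃ n : ℕ, 1 ≤ n ∧ r ≤ (n : ℝ) ^ d := by
    obtain ⟨n, hn⟩ := exists_nat_ge r
    refine ⟨n + 1, by omega, ?_⟩
    have h1 : (1 : ℝ) ≤ ((n + 1 : ℕ) : ℝ) := by exact_mod_cast Nat.succ_pos n
    refine le_trans ?_ (le_self_pow₀ h1 hd)
    push_cast
    linarith
  obtain ⟨h1, h2⟩ := Nat.find_spec hex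
  refine ⟨Nat.find hex, h1, h2, ?_⟩
  rcases h1.eq_or_lt with h | h
  · rw [← h]
    have : 0 ≤ 2 ^ d * r := by positivity
    simpa using this
  · obtain ⟨k, hk⟩ : ∃ k, Nat.find hex = k + 1 := ⟨Nat.find hex - 1, by omega⟩
    have h3 := Nat.find_min hex (m := k) (by omega)
    have hk1 : 1 ≤ k := by omega
    have h4 : (k : ℝ) ^ d < r := by
      by_contra h5
      exact h3 ⟨hk1, not_lt.1 h5⟩
    rw [hk]
    have hk2 : (1 : ℝ) ≤ k := by exact_mod_cast hk1
    calc ((k + 1 : ℕ) : ℝ) ^ d ≤ (2 * k) ^ d := by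
          push_cast
          gcongr
          linarith
      _ = 2 ^ d * (k : ℝ) ^ d := mul_pow _ _ _
      _ ≤ 2 ^ d * r := by gcongr
      _ ≤ _ := by linarith

theorem half_le_one_sub_exp_neg {t : ℝ} (h0 : 0 ≤ t) (h1 : t ≤ 1) :
    t / 2 ≤ 1 - Real.exp (-t) := by
  have h2 : t + 1 ≤ Real.exp t := Real.add_one_le_exp t
  have h3 : Real.exp (-t) ≤ (t + 1)⁻¹ := by
    rw [Real.exp_neg]
    exact inv_anti₀ (by linarith) h2
  have h4 : (t + 1)⁻¹ ≤ 1 - t / 2 := by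
    rw [inv_le_iff_one_le_mul₀ (by linarith)]
    nlinarith
  linarith

variable {φ ν : Space d → ℝ} {c l : ℝ} {a x : Space d} {M K : ℝ}

/-- If the cube is divided into `n ^ d` cells, the capacity of the part of the archipelago in it is
at least a constant times the number of half cells that contain a point of the configuration. -/
theorem sum_indicator_le_newtonCap (hd : 3 ≤ d) (hl : 0 < l) {n : ℕ} (hn : 1 ≤ n)
    (hx : x ∈ cube a l) {ρ B : ℝ} (hρ : 0 < ρ) (hρφ : ∀ p ∈ cube a l, ρ ≤ φ p)
    (hρn : 2 * ρ ≤ l / n / 4) (hB0 : 0 ≤ B)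
    (hB : ρ ^ (d - 2) * (2 * d * l) ^ 2 ≤ B * (l / n / 4) ^ d) (S : Set (Space d)) :
    ∑ k : Fin d → Fin n, {T : Set (Space d) | pointCount T (halfCell a (l / n) k) ≠ 0}.indicator
        (fun _ => ENNReal.ofReal (capConst d B * ρ ^ (d - 2))) S ≤
      newtonCap (archipelago φ S ∩ cube a l) := by
  classical
  have hn0 : (0 : ℝ) < n := by exact_mod_cast hn
  have hs : 0 < l / n := by positivity
  have hns : n * (l / n) = l := by field_simp
  have hd1 : (3 : ℝ) ≤ d := by exact_mod_cast hd
  set s : Finset (Fin d → Fin n) :=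
    Finset.univ.filter fun k => pointCount S (halfCell a (l / n) k) ≠ 0 with hsdef
  have hex : ∀ k : Fin d → Fin n, ∃ p, k ∈ s → p ∈ S ∩ halfCell a (l / n) k := by
    intro k
    by_cases hk : k ∈ s
    · rw [hsdef, Finset.mem_filter, pointCount, Set.encard_ne_zero] at hk
      obtain ⟨p, hp⟩ := hk.2
      exact ⟨p, fun _ => hp⟩
    · exact ⟨0, fun h => absurd h hk⟩
  choose p hp using hex
  have hballQ : ∀ k ∈ s, Metric.ball (p k) (l / n / 4) ⊆ cube a l := fun k hk => by
    have := ball_subset_cube_of_mem_halfCell hs (hp k hk).2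
    rwa [hns] at this
  have hQx : cube a l ⊆ Metric.ball x (2 * d * l) := fun y hy => by
    have := dist_le_of_mem_cube hl.le hy hx
    rw [Metric.mem_ball]
    nlinarith [mul_pos (by linarith : (0 : ℝ) < d) hl]
  have hcard := card_mul_le_newtonCap hd s p (E := archipelago φ S ∩ cube a l) hρ hρn
    (fun k hk j hj hkj => disjoint_ball_of_mem_halfCell hs hkj (hp k hk).2 (hp j hj).2) x
    (by positivity) (fun k hk => (hballQ k hk).trans hQx) hB0 hB
    (fun k hk => by
      refine Set.subset_inter ?_ ?_
      · have hpQ : p k ∈ cube a l := hballQ k hk (Metric.mem_ball_self (by positivity))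
        exact (Metric.closedBall_subset_closedBall (hρφ _ hpQ)).trans
          (Set.subset_biUnion_of_mem (u := fun p => Metric.closedBall p (φ p)) (hp k hk).1)
      · exact (Metric.closedBall_subset_ball (by linarith)).trans (hballQ k hk))
  refine le_trans (le_of_eq ?_) hcard
  simp only [Set.indicator, Set.mem_ofPred_eq]
  rw [← Finset.sum_filter, Finset.sum_const, nsmul_eq_mul]

/-- A bound for the ratio `φ(x) ^ (d - 2) n ^ d / l ^ (d - 2)`, where `n ^ d` is the number of cells
into which a Whitney cube of sidelength `l` is divided. -/
noncomputable def cellConst (d : ℕ) (M K : ℝ) : ℝ := (5 * d) ^ (d - 2) + 2 ^ d * (M * K)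

/-- The constant `B` of `card_mul_le_newtonCap` for the division of a Whitney cube into cells. -/
noncomputable def crowdingConst (d : ℕ) (M K : ℝ) : ℝ := 4 ^ (d + 1) * d ^ 2 * cellConst d M K

/-- The constant in the lower bound for the mean capacity. -/
noncomputable def lowerConst (d : ℕ) (M K : ℝ) : ℝ :=
  capConst d (crowdingConst d M K) /
    ((8 * M * cellConst d M K) ^ (d - 2) * (M ^ 2 * 2 ^ d * 2))

theorem one_le_cellConst (hd : 3 ≤ d) (hM : 0 ≤ M) (hK : 0 ≤ K) : 1 ≤ cellConst d M K := by
  have hd1 : (3 : ℝ) ≤ d := by exact_mod_cast hd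
  have h1 : (1 : ℝ) ≤ (5 * d) ^ (d - 2) := one_le_pow₀ (by linarith)
  have h2 : 0 ≤ 2 ^ d * (M * K) := by positivity
  unfold cellConst
  linarith

theorem crowdingConst_pos (hd : 3 ≤ d) (hM : 0 ≤ M) (hK : 0 ≤ K) : 0 < crowdingConst d M K := by
  have h1 := one_le_cellConst hd hM hK
  have hd1 : (3 : ℝ) ≤ d := by exact_mod_cast hd
  unfold crowdingConst
  positivity

theorem lowerConst_pos (hd : 3 ≤ d) (hM : 0 < M) (hK : 0 ≤ K) : 0 < lowerConst d M K := by
  have h1 := one_le_cellConst hd hM.le hK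
  have h2 := capConst_pos (d := d) (crowdingConst_pos hd hM.le hK).le
  unfold lowerConst
  positivity

/-- The cube is divided into `n ^ d` cells, where `n ^ d` is of the order of `max 1 μ(Q)`, so that
each half cell is occupied with probability at least a constant times `μ(Q) / n ^ d`. The growth
condition gives `φ(x) ^ (d - 2) n ^ d ≤ const l ^ (d - 2)`, which is the separation that
`card_mul_le_newtonCap` requires, so the capacities of the balls in the occupied cells add up, up to
a constant. -/
theorem le_lintegral_newtonCap (hd : 3 ≤ d) (hc0 : 0 ≤ c) (hc1 : c < 1) (hl : 0 < l)
    (hφ0 : ∀ y ∈ unitBall d, 0 ≤ φ y) (hν0 : ∀ y ∈ unitBall d, 0 ≤ ν y)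
    (hφc : ∀ y ∈ unitBall d, φ y ≤ c * (1 - ‖y‖))
    (hQ : ∀ y ∈ cube a l, l ≤ 1 - ‖y‖ ∧ 1 - ‖y‖ ≤ 5 * d * l) (hx : x ∈ cube a l)
    (hM1 : 1 ≤ M) (hM : ComparableNear φ ν x l (reach d c) M)
    (hK0 : 0 ≤ K) (hK : (1 - ‖x‖) ^ 2 * (φ x ^ (d - 2) * ν x) ≤ K)
    {Ω : Type*} [MeasurableSpace Ω] {Pr : Measure Ω} [IsProbabilityMeasure Pr]
    {P : Ω → Set (Space d)} (hP : IsPoissonProcess Pr (meanMeasure ν) P) :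
    ENNReal.ofReal (lowerConst d M K * φ x ^ (d - 2)) * meanMeasure ν (cube a l) ≤
      ∫⁻ ω, newtonCap (archipelago φ (P ω) ∩ cube a l) ∂Pr := by
  classical
  have hdR := natCast_le_reach (d := d) hc0 hc1
  have hd1 : (3 : ℝ) ≤ d := by exact_mod_cast hd
  have hM0 : 0 < M := by linarith
  have hQball : cube a l ⊆ unitBall d := fun y hy => by
    have := hQ y hy
    simp only [unitBall, Metric.mem_ball, dist_zero_right]
    linarith
  have hMQ : ∀ y ∈ cube a l, (φ y ≤ M * φ x ∧ φ x ≤ M * φ y) ∧ (ν y ≤ M * ν x ∧ ν x ≤ M * ν y) :=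
    fun y hy => hM y ((dist_le_of_mem_cube hl.le hx hy).trans (by gcongr))
      (by linarith [hQ y hy])
  have hxν := hν0 x (hQball hx)
  rcases (hφ0 x (hQball hx)).eq_or_lt with hφx | hφx
  · rw [← hφx, zero_pow (by omega)]
    simp
  have hd2 : l ^ d = l ^ (d - 2) * l ^ 2 := by rw [← pow_add]; congr 1; omega
  -- the mean number of points in the cube
  have hQle : meanMeasure ν (cube a l) ≤ ENNReal.ofReal (M * ν x * l ^ d) := by
    rw [ENNReal.ofReal_mul (by positivity), ← volume_cube a hl.le]
    exact meanMeasure_le (measurableSet_cube a l) hQball fun y hy => (hMQ y hy).2.1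
  have hQfin : meanMeasure ν (cube a l) ≠ ∞ := (hQle.trans_lt ENNReal.ofReal_lt_top).ne
  set r : ℝ := (meanMeasure ν (cube a l)).toReal with hr
  have hr0 : 0 ≤ r := ENNReal.toReal_nonneg
  have hrle : r ≤ M * ν x * l ^ d := ENNReal.toReal_le_of_le_ofReal (by positivity) hQle
  obtain ⟨n, hn1, hrn, hnr⟩ := exists_nat_pow_comparable (d := d) (by omega) hr0
  have hn0 : (1 : ℝ) ≤ n := by exact_mod_cast hn1
  set L := cellConst d M K with hL
  have hL1 : 1 ≤ L := one_le_cellConst hd hM0.le hK0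
  set B := crowdingConst d M K with hB
  have hB0 : 0 < B := crowdingConst_pos hd hM0.le hK0
  have hcap := capConst_pos (d := d) hB0.le
  have hφl : φ x ≤ 5 * d * l := by
    have h1 := hφc x (hQball hx)
    have h2 := hQ x hx
    nlinarith
  have hKl : φ x ^ (d - 2) * ν x * l ^ 2 ≤ K := by
    refine le_trans ?_ hK
    rw [mul_comm ((1 - ‖x‖) ^ 2)]
    have := (hQ x hx).1
    gcongr
  have hcell : φ x ^ (d - 2) * n ^ d ≤ L * l ^ (d - 2) := by
    calc φ x ^ (d - 2) * n ^ d ≤ φ x ^ (d - 2) * (1 + 2 ^ d * (M * ν x * l ^ d)) := by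
          gcongr
          exact hnr.trans (by gcongr)
      _ = φ x ^ (d - 2) + 2 ^ d * (M * (φ x ^ (d - 2) * ν x * l ^ 2)) * l ^ (d - 2) := by
          rw [hd2]; ring
      _ ≤ (5 * d * l) ^ (d - 2) + 2 ^ d * (M * K) * l ^ (d - 2) := by gcongr
      _ = L * l ^ (d - 2) := by rw [hL, cellConst, mul_pow (5 * (d : ℝ))]; ring
  have hφn : φ x * n ≤ L * l := by
    refine le_of_pow_le_pow_left₀ (n := d - 2) (by omega) (by positivity) ?_
    calc (φ x * n) ^ (d - 2) = φ x ^ (d - 2) * n ^ (d - 2) := mul_pow _ _ _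
      _ ≤ φ x ^ (d - 2) * n ^ d := by gcongr; omega
      _ ≤ L * l ^ (d - 2) := hcell
      _ ≤ L ^ (d - 2) * l ^ (d - 2) := by gcongr; exact le_self_pow₀ hL1 (by omega)
      _ = _ := (mul_pow _ _ _).symm
  -- smaller than the radii of the balls centred in the cube, and than half the separation
  -- `l / (4 n)` of the centres
  set ρ : ℝ := φ x / (8 * M * L) with hρ
  have hρ0 : 0 < ρ := by positivity
  have hρφ : ∀ p ∈ cube a l, ρ ≤ φ p := by
    intro p hp
    rw [hρ, div_le_iff₀ (by positivity)]
    have h1 := (hMQ p hp).1.2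
    have h2 := hφ0 p (hQball hp)
    have h3 : M * φ p ≤ M * φ p * L := le_mul_of_one_le_right (by positivity) hL1
    nlinarith [mul_nonneg (mul_nonneg hM0.le h2) (by linarith : (0 : ℝ) ≤ L)]
  have hρn : 2 * ρ ≤ l / n / 4 := by
    have h2 : 2 * ρ = φ x / L / M / 4 := by rw [hρ]; field_simp; norm_num
    have h3 : φ x / L / M ≤ φ x / L := div_le_self (by positivity) hM1
    have h4 : φ x / L ≤ l / n := by
      rw [div_le_div_iff₀ (by positivity) (by positivity), mul_comm l]
      exact hφn
    rw [h2]
    linarith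
  have hρx : ρ ≤ φ x := hρφ x hx
  have hcrowd : ρ ^ (d - 2) * (2 * d * l) ^ 2 ≤ B * (l / n / 4) ^ d := by
    have h1 : B * (l / n / 4) ^ d = 4 * d ^ 2 * l ^ 2 * (L * l ^ (d - 2) / n ^ d) := by
      rw [hB, crowdingConst, div_pow, div_pow, hd2, pow_succ, ← hL]
      field_simp
    rw [h1]
    calc ρ ^ (d - 2) * (2 * d * l) ^ 2 ≤ φ x ^ (d - 2) * (2 * d * l) ^ 2 := by gcongr
      _ = 4 * d ^ 2 * l ^ 2 * φ x ^ (d - 2) := by ring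
      _ ≤ _ := by
        gcongr
        rw [le_div_iff₀ (by positivity)]
        exact hcell
  -- each half cell is occupied with probability at least `τ / 2`
  set τ : ℝ := r / (M ^ 2 * 2 ^ d * n ^ d) with hτ
  have hτ0 : 0 ≤ τ := by positivity
  have hτ1 : τ ≤ 1 := by
    rw [hτ, div_le_one (by positivity)]
    refine hrn.trans (le_mul_of_one_le_left (by positivity) ?_)
    exact one_le_mul_of_one_le_of_one_le (one_le_pow₀ hM1) (one_le_pow₀ (by norm_num))
  have hs : 0 < l / n := by positivity
  have hns : n * (l / n) = l := by field_simp
  have hocc : ∀ k : Fin d → Fin n, ENNReal.ofReal (τ / 2) ≤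
      Pr {ω | pointCount (P ω) (halfCell a (l / n) k) ≠ 0} := by
    intro k
    have hmeas : MeasurableSet (halfCell a (l / n) k) := measurableSet_cube _ _
    have hsub : halfCell a (l / n) k ⊆ cube a l := fun p hp => by
      have := ball_subset_cube_of_mem_halfCell hs hp (Metric.mem_ball_self (by positivity))
      rwa [hns] at this
    have hfin : meanMeasure ν (halfCell a (l / n) k) ≠ ∞ :=
      ((measure_mono hsub).trans_lt hQfin.lt_top).ne
    have hge : ENNReal.ofReal τ ≤ meanMeasure ν (halfCell a (l / n) k) := by
      have h1 : τ ≤ ν x / M * (l / n / 2) ^ d := by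
        rw [hτ, div_le_iff₀ (by positivity), div_pow, div_pow]
        refine hrle.trans (le_of_eq ?_)
        field_simp
      refine (ENNReal.ofReal_le_ofReal h1).trans ?_
      rw [ENNReal.ofReal_mul (by positivity)]
      have h2 : volume (halfCell a (l / n) k) = ENNReal.ofReal ((l / n / 2) ^ d) :=
        volume_cube _ (by positivity)
      rw [← h2]
      refine le_meanMeasure hmeas (hsub.trans hQball) fun y hy => ?_
      rw [div_le_iff₀ hM0, mul_comm]
      exact (hMQ y (hsub hy)).2.2
    rw [hP.measure_pointCount_ne_zero hmeas hfin]
    refine ENNReal.ofReal_le_ofReal ((half_le_one_sub_exp_neg hτ0 hτ1).trans ?_)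
    have h3 : τ ≤ (meanMeasure ν (halfCell a (l / n) k)).toReal :=
      (ENNReal.ofReal_le_iff_le_toReal hfin).1 hge
    gcongr
  set q : ℝ := capConst d B * ρ ^ (d - 2) with hq
  have hq0 : 0 ≤ q := by positivity
  have hmeasE : ∀ k : Fin d → Fin n,
      MeasurableSet {ω | pointCount (P ω) (halfCell a (l / n) k) ≠ 0} := fun k =>
    hP.measurable_count _ (measurableSet_cube _ _) (measurableSet_singleton 0).compl
  calc ENNReal.ofReal (lowerConst d M K * φ x ^ (d - 2)) * meanMeasure ν (cube a l)
      = ENNReal.ofReal (lowerConst d M K * φ x ^ (d - 2)) * ENNReal.ofReal r := by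
        rw [hr, ENNReal.ofReal_toReal hQfin]
    _ = ∑ _k : Fin d → Fin n, ENNReal.ofReal q * ENNReal.ofReal (τ / 2) := by
        rw [Finset.sum_const, nsmul_eq_mul, ← ENNReal.ofReal_mul hq0,
          ← ENNReal.ofReal_natCast, ← ENNReal.ofReal_mul (Nat.cast_nonneg _),
          ← ENNReal.ofReal_mul (mul_nonneg (lowerConst_pos hd hM0 hK0).le (by positivity))]
        congr 1
        simp only [Finset.card_univ, Fintype.card_pi, Fintype.card_fin, Finset.prod_const,
          Nat.cast_pow]
        rw [hq, hτ, hρ, lowerConst, ← hL, ← hB, div_pow]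
        field_simp
    _ ≤ ∑ k : Fin d → Fin n, ENNReal.ofReal q *
          Pr {ω | pointCount (P ω) (halfCell a (l / n) k) ≠ 0} := by
        gcongr with k
        exact hocc k
    _ = ∫⁻ ω, ∑ k : Fin d → Fin n,
          {ω | pointCount (P ω) (halfCell a (l / n) k) ≠ 0}.indicator
            (fun _ => ENNReal.ofReal q) ω ∂Pr := by
        rw [lintegral_finsetSum _ fun k _ => measurable_const.indicator (hmeasE k)]
        refine Finset.sum_congr rfl fun k _ => ?_
        rw [lintegral_indicator_const (hmeasE k)]
    _ ≤ _ := lintegral_mono fun ω =>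
        sum_indicator_le_newtonCap hd hl hn1 hx hρ0 hρφ hρn hB0.le hcrowd (P ω)

end LowerBound

/-! ### Consequences of the Harnack condition -/

section Harnack

variable {d : ℕ} {C r₀ : ℝ}

/-- With `y = x`, the condition reads `f x ≤ C * f x`. -/
theorem nonneg_of_comparable {f : Space d → ℝ} (hC : 1 < C)
    (hf : ∀ x ∈ unitBall d, ∀ y ∈ Metric.ball x ((1 - ‖x‖) / 2), 1 / C * f x ≤ f y ∧ f y ≤ C * f x)
    {x : Space d} (hx : x ∈ unitBall d) : 0 ≤ f x := by
  have hx1 : ‖x‖ < 1 := by simpa [unitBall] using hx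
  have h1 := (hf x hx x (Metric.mem_ball_self (by linarith))).2
  nlinarith

/-- The growth condition near the sphere extends to the whole ball, with a larger constant. -/
theorem exists_growth_bound (hd : 3 ≤ d) (hC : 1 < C) (hr₀ : r₀ < 1) (K : ℝ) :
    ∃ K' : ℝ, 0 ≤ K' ∧ ∀ φ ν : Space d → ℝ,
      (∀ x ∈ unitBall d, ∀ y ∈ Metric.ball x ((1 - ‖x‖) / 2),
        (1 / C * φ x ≤ φ y ∧ φ y ≤ C * φ x) ∧ (1 / C * ν x ≤ ν y ∧ ν y ≤ C * ν x)) →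
      (∀ x ∈ unitBall d, r₀ ≤ ‖x‖ →
        (1 - ‖x‖) * φ x ^ (d - 2) * ν x ≤ K * (1 / (1 - ‖x‖))) →
      ∀ x ∈ unitBall d, (1 - ‖x‖) ^ 2 * (φ x ^ (d - 2) * ν x) ≤ K' := by
  have hC0 : 0 < C := by linarith
  set r₁ : ℝ := max r₀ 0 with hr₁
  have hr₁0 : 0 ≤ r₁ := le_max_right _ _
  have hr₁1 : r₁ < 1 := max_lt hr₀ one_pos
  have hh : 0 < 1 - r₁ := by linarith
  obtain ⟨N, hN⟩ := exists_nat_gt (4 / (1 - r₁))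
  rw [div_lt_iff₀ hh] at hN
  set L : ℝ := (C ^ N) ^ (d - 2) * C ^ N with hL
  have hL1 : 1 ≤ L :=
    one_le_mul_of_one_le_of_one_le (one_le_pow₀ (one_le_pow₀ hC.le)) (one_le_pow₀ hC.le)
  have hK0 : 0 ≤ max K 0 := le_max_right _ _
  refine ⟨L * (max K 0 / (1 - r₁) ^ 2), by positivity, fun φ ν hcomp hgrow x hx => ?_⟩
  have hφ0 : ∀ y ∈ unitBall d, 0 ≤ φ y := fun y hy =>
    nonneg_of_comparable hC (fun x hx y hy => (hcomp x hx y hy).1) hy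
  have hν0 : ∀ y ∈ unitBall d, 0 ≤ ν y := fun y hy =>
    nonneg_of_comparable hC (fun x hx y hy => (hcomp x hx y hy).2) hy
  have hx1 : ‖x‖ < 1 := by simpa [unitBall] using hx
  have hgrow' : ∀ y ∈ unitBall d, r₁ ≤ ‖y‖ →
      (1 - ‖y‖) ^ 2 * (φ y ^ (d - 2) * ν y) ≤ max K 0 := by
    intro y hy hry
    have hy1 : 0 < 1 - ‖y‖ := by
      have : ‖y‖ < 1 := by simpa [unitBall] using hy
      linarith
    have h1 := hgrow y hy ((le_max_left _ _).trans hry)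
    rw [mul_one_div, le_div_iff₀ hy1] at h1
    calc _ = (1 - ‖y‖) * φ y ^ (d - 2) * ν y * (1 - ‖y‖) := by ring
      _ ≤ K := h1
      _ ≤ _ := le_max_left _ _
  have hsq : (1 - r₁) ^ 2 ≤ 1 := pow_le_one₀ hh.le (by linarith)
  rcases le_total r₁ ‖x‖ with hrx | hrx
  · calc _ ≤ max K 0 := hgrow' x hx hrx
      _ ≤ max K 0 / (1 - r₁) ^ 2 := le_div_self hK0 (by positivity) hsq
      _ ≤ _ := le_mul_of_one_le_left (by positivity) hL1
  -- otherwise, compare with a point of norm `r₁`, where the condition is assumed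
  · set z : Space d := EuclideanSpace.single ⟨0, by omega⟩ r₁ with hz
    have hz1 : ‖z‖ = r₁ := by simp [hz, abs_of_nonneg hr₁0]
    have hzB : z ∈ unitBall d := by simpa [unitBall, hz1] using hr₁1
    have hdist : dist z x < N * ((1 - r₁) / 2) := by
      have h1 : dist z x ≤ ‖z‖ + ‖x‖ := dist_le_norm_add_norm _ _
      linarith
    have h1 := le_pow_mul_of_dist_lt hC0.le (fun x hx y hy => (hcomp x hx y hy).1.2) hh N z x
      (by linarith) (by linarith) hdist
    have h2 := le_pow_mul_of_dist_lt hC0.le (fun x hx y hy => (hcomp x hx y hy).2.2) hh N z x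
      (by linarith) (by linarith) hdist
    have h3 := hgrow' z hzB hz1.ge
    have hφx := hφ0 x hx
    have hνx := hν0 x hx
    have hφz := hφ0 z hzB
    have h4 : (1 - ‖x‖) ^ 2 ≤ 1 := pow_le_one₀ (by linarith) (by linarith [norm_nonneg x])
    have h5 : φ z ^ (d - 2) * ν z ≤ max K 0 / (1 - r₁) ^ 2 := by
      rw [le_div_iff₀ (by positivity), mul_comm, ← hz1]
      exact h3
    calc (1 - ‖x‖) ^ 2 * (φ x ^ (d - 2) * ν x) ≤ 1 * (φ x ^ (d - 2) * ν x) := by gcongr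
      _ ≤ 1 * ((C ^ N * φ z) ^ (d - 2) * (C ^ N * ν z)) := by gcongr
      _ = L * (φ z ^ (d - 2) * ν z) := by rw [hL, mul_pow]; ring
      _ ≤ _ := by gcongr

/-- The Harnack chains have a number of steps that depends only on the ratio `R`. -/
theorem exists_comparableNear (hC : 1 < C) (R : ℝ) (d : ℕ) :
    ∃ M : ℝ, 1 ≤ M ∧ ∀ φ ν : Space d → ℝ,
      (∀ x ∈ unitBall d, ∀ y ∈ Metric.ball x ((1 - ‖x‖) / 2),
        (1 / C * φ x ≤ φ y ∧ φ y ≤ C * φ x) ∧ (1 / C * ν x ≤ ν y ∧ ν y ≤ C * ν x)) →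
      ∀ (x : Space d) (l : ℝ), 0 < l → l ≤ 1 - ‖x‖ → ComparableNear φ ν x l R M := by
  have hC0 : 0 < C := by linarith
  obtain ⟨N, hN⟩ := exists_nat_gt (4 * R)
  refine ⟨C ^ N, one_le_pow₀ hC.le, fun φ ν hcomp x l hl hx p hxp hp => ?_⟩
  have hdist : dist x p < N * (l / 2 / 2) := by nlinarith
  have hl2 : 0 < l / 2 := by linarith
  have hx' : l / 2 ≤ 1 - ‖x‖ := by linarith
  have hφ := le_pow_mul_of_dist_lt hC0.le (fun x hx y hy => (hcomp x hx y hy).1.2) hl2 N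
  have hν := le_pow_mul_of_dist_lt hC0.le (fun x hx y hy => (hcomp x hx y hy).2.2) hl2 N
  have hdist' := hdist
  rw [dist_comm] at hdist'
  exact ⟨⟨hφ x p hx' hp hdist, hφ p x hp hx' hdist'⟩, hν x p hx' hp hdist, hν p x hp hx' hdist'⟩

end Harnack

end PercolationDiffusion

theorem lemma3 (d : ℕ) (hd : 3 ≤ d) (C c K r₀ : ℝ) (hC : 1 < C) (hc : c < 1) (hr₀ : r₀ < 1) :
    ∃ M : ℝ, 1 ≤ M ∧
      ∀ φ ν : PercolationDiffusion.Space d → ℝ, Measurable φ → Measurable ν →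
      -- `φ` and `ν` are roughly constant at the scale of the distance to the sphere
      (∀ x ∈ PercolationDiffusion.unitBall d, ∀ y ∈ Metric.ball x ((1 - ‖x‖) / 2),
        (1 / C * φ x ≤ φ y ∧ φ y ≤ C * φ x) ∧ (1 / C * ν x ≤ ν y ∧ ν y ≤ C * ν x)) →
      (∀ x ∈ PercolationDiffusion.unitBall d, φ x / (1 - ‖x‖) ≤ c) →
      -- `(1 - |x|) φ(x) ^ (d - 2) ν(x) = O(1 / (1 - |x|))` as `|x| → 1`
      (∀ x ∈ PercolationDiffusion.unitBall d, r₀ ≤ ‖x‖ →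
        (1 - ‖x‖) * φ x ^ (d - 2) * ν x ≤ K * (1 / (1 - ‖x‖))) →
      ∀ {Ω : Type*} [MeasurableSpace Ω] (Pr : Measure Ω) [IsProbabilityMeasure Pr]
        (P : Ω → Set (PercolationDiffusion.Space d)),
      PercolationDiffusion.IsPoissonProcess Pr (PercolationDiffusion.meanMeasure ν) P →
      ∀ Q : Set (PercolationDiffusion.Space d), PercolationDiffusion.IsWhitneyCube Q →
      ∀ x ∈ Q,
        ENNReal.ofReal (M⁻¹ * φ x ^ (d - 2)) * PercolationDiffusion.meanMeasure ν Q ≤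
            ∫⁻ ω, PercolationDiffusion.newtonCap
              (PercolationDiffusion.archipelago φ (P ω) ∩ Q) ∂Pr ∧
          ∫⁻ ω, PercolationDiffusion.newtonCap
              (PercolationDiffusion.archipelago φ (P ω) ∩ Q) ∂Pr ≤
            ENNReal.ofReal (M * φ x ^ (d - 2)) * PercolationDiffusion.meanMeasure ν Q := by
  open PercolationDiffusion in
  -- `c` may be negative, in which case the hypotheses are contradictory; the estimates use `0 ≤ c`
  set c' : ℝ := max c 0 with hc'
  have hc'0 : 0 ≤ c' := le_max_right _ _
  have hc'1 : c' < 1 := max_lt hc one_pos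
  obtain ⟨K', hK'0, hK'⟩ := exists_growth_bound hd hC hr₀ K
  obtain ⟨M, hM1, hM⟩ := exists_comparableNear hC (reach d c') d
  have hM0 : 0 < M := by linarith
  have hlow := lowerConst_pos hd hM0 hK'0
  set U : ℝ := M ^ d * unitBallVolume d * reach d c' ^ d with hU
  refine ⟨max 1 (max U (lowerConst d M K')⁻¹), le_max_left _ _, ?_⟩
  intro φ ν _ _ hcomp hφc hgrow Ω _ Pr _ P hP Q hQ x hx
  obtain ⟨a, l, hl, rfl, hgeo⟩ := hQ.exists_cube hd
  have hφ0 : ∀ y ∈ unitBall d, 0 ≤ φ y := fun y hy =>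
    nonneg_of_comparable hC (fun x hx y hy => (hcomp x hx y hy).1) hy
  have hν0 : ∀ y ∈ unitBall d, 0 ≤ ν y := fun y hy =>
    nonneg_of_comparable hC (fun x hx y hy => (hcomp x hx y hy).2) hy
  have hφc' : ∀ y ∈ unitBall d, φ y ≤ c' * (1 - ‖y‖) := by
    intro y hy
    have hy1 : ‖y‖ < 1 := by simpa [unitBall] using hy
    have h1 := (hφc y hy).trans (le_max_left c 0)
    rwa [div_le_iff₀ (by linarith)] at h1
  have hxB : x ∈ unitBall d := by
    have := hgeo x hx
    simp only [unitBall, Metric.mem_ball, dist_zero_right]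
    linarith
  have hnear := hM φ ν hcomp x l hl (hgeo x hx).1
  have hφx := pow_nonneg (hφ0 x hxB) (d - 2)
  constructor
  · refine le_trans ?_ (le_lintegral_newtonCap hd hc'0 hc'1 hl hφ0 hν0 hφc' hgeo hx hM1 hnear hK'0
      (hK' φ ν hcomp hgrow x hxB) hP)
    gcongr
    exact inv_le_of_inv_le₀ hlow ((le_max_right _ _).trans (le_max_right _ _))
  · refine (lintegral_newtonCap_le hd hc'0 hc'1 hl hφ0 hν0 hφc' hgeo hx hM0 hnear hP).trans ?_
    gcongr
    exact (le_max_left _ _).trans (le_max_right _ _)
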